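/- Every continuous map $f\colon A \to B$ of topological spaces has a functorial factorization $A \xrightarrow{j} \widetilde{B} \xrightarrow{p} B$ such that $j$ is a relative CW-complex and $p$ is a weak homotopy equivalence. Functorial means that a commutative square with left side $a\colon A \to A'$, right side $b\colon B \to B'$, top $f\colon A\to B$ and bottom $f'\colon A'\to B'$ induces a map $\tilde b\colon \widetilde{B} \to \widetilde{B}'$ with $\tilde b\circ j = j'\circ a$ and $p'\circ\tilde b = b\circ p$, compatibly with identities and composition of squares. More precisely, such a factorization is given by the following construction. Put $A_{-1} = A$. For $n \ge 0$, given $A_{n-1}$ with a map to $B$, the space $A_n$ is obtained from $A_{n-1}$ by attaching one $n$-cell for every commutative square $$\begin{array}{ccc} S^{n-1} & \xrightarrow{\ \alpha\ } & A_{n-1} \\ \downarrow & & \downarrow \\ D^n & \xrightarrow{\ \beta\ } & B \end{array}$$ (where $S^{-1} = \emptyset$), with attaching map $\alpha$, and the map $A_{n-1} \to B$ is extended to $A_n \to B$ by $\beta$ on that cell. Then $\widetilde{B} = \operatorname{colim}_n A_n$, with $j\colon A_{-1}\to\widetilde B$ the canonical map and $p$ induced by the maps $A_n \to B$. The map $\tilde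 b$ is the colimit of maps $f_n\colon A_n \to A_n'$ with $f_{-1} = a$, each $f_n$ extending $f_{n-1}$ and taking the cell of a square $(\alpha,\beta)$ identically to the cell of the square $(f_{n-1}\circ\alpha,\ b\circ\beta)$. Applied to the maps $\emptyset \to B$, this gives a functorial CW-approximation: a functor $B \mapsto \widetilde{B}$ from spaces to spaces together with a natural map $\widetilde{B} \to B$ that is a weak homotopy equivalence from a CW-complex for every space $B$. -/

import Mathlib

open CategoryTheory CategoryTheory.Limits HomotopicalAlgebra TopCat
open scoped Topology Topology.Homotopy

universe u

namespace FunctorialCW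

noncomputable section

/-! ### Weak homotopy equivalences -/

section WeakEquivalence

variable {X Y : Type*} [TopologicalSpace X] [TopologicalSpace Y]

/-- The map induced by a continuous map on sets of path components. -/
def pathComponentsMap (f : C(X, Y)) : ZerothHomotopy X → ZerothHomotopy Y :=
  Quotient.map f fun _ _ h => h.map f.continuous

/-- The map induced by a continuous map `f` on `n`-dimensional generalized loops. -/
def genLoopMap (f : C(X, Y)) (n : ℕ) (x : X) (γ : GenLoop (Fin n) X x) :
    GenLoop (Fin n) Y (f x) :=
  ⟨f.comp γ.1, fun y hy => congrArg f (γ.2 y hy)⟩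

/-- The map `π_n(X, x) → π_n(Y, f x)` induced by a continuous map `f`. -/
def homotopyGroupMap (f : C(X, Y)) (n : ℕ) (x : X) : π_ n X x → π_ n Y (f x) :=
  Quotient.map (genLoopMap f n x) fun _ _ h =>
    ContinuousMap.HomotopicRel.comp_continuousMap h f

/-- A weak homotopy equivalence: a continuous map which is bijective on path components and, for
every `n ≥ 1` and every basepoint of the source, bijective on `π_n`. (The maps on `π_n`, `n ≥ 1`,
are group homomorphisms, so that bijective means isomorphism.) -/
def IsWeakHomotopyEquiv (f : C(X, Y)) : Prop :=
  Function.Bijective (pathComponentsMap f) ∧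
    ∀ n : ℕ, 1 ≤ n → ∀ x : X, Function.Bijective (homotopyGroupMap f n x)

end WeakEquivalence

/-- The class of weak homotopy equivalences in the category of topological spaces. -/
def weakEquivalences : MorphismProperty TopCat.{u} := fun _ _ f => IsWeakHomotopyEquiv f.hom

/-- The class of maps which admit the structure of a relative CW-complex. -/
def relativeCWComplexes : MorphismProperty TopCat.{u} := fun _ _ f =>
  Nonempty (RelativeCWComplex f)

/-! ### Attaching a cell for every commutative square

For `c : RelativeCWComplex j`, the space `c.F.obj n` is the `(n - 1)`-skeleton `A_{n-1}`, so that
`c.F.obj 0` is (isomorphic to) `A = A_{-1}`, and `n`-cells are attached to `c.F.obj n` in order to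
obtain `c.F.obj (n + 1)`. -/

/-- The commutative squares with left side `S^{n-1} → D^n` and right side `q : X → B`; the top of
the square `s` is `s.left : S^{n-1} → X`, and its bottom is `s.right : D^n → B`.
For `n = 0` the sphere is empty, and this is just a map `D^0 → B`. -/
abbrev Square (n : ℕ) {X B : TopCat.{u}} (q : X ⟶ B) : Type u :=
  Arrow.mk (diskBoundaryInclusion.{u} n) ⟶ Arrow.mk q

section

variable {A Y B : TopCat.{u}} {j : A ⟶ Y}

/-- The map `A_{n-1} → B`, the composite of `A_{n-1} → Y` and `p : Y → B`. -/
def stageMap (c : RelativeCWComplex j) (p : Y ⟶ B) (n : ℕ) : c.F.obj n ⟶ B :=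
  c.incl.app n ≫ p

/-- The index type of the `n`-cells of a relative CW-complex. -/
abbrev CellIndex (c : RelativeCWComplex j) (n : ℕ) : Type u := (c.attachCells n (not_isMax n)).ι

/-- The attaching map `S^{n-1} → A_{n-1}` of an `n`-cell. -/
def attachingMap (c : RelativeCWComplex j) (n : ℕ) (e : CellIndex c n) :
    diskBoundary.{u} n ⟶ c.F.obj n :=
  (c.attachCells n (not_isMax n)).cofan₁.inj e ≫ (c.attachCells n (not_isMax n)).g₁

/-- The characteristic map `D^n → A_n` of an `n`-cell. -/
def characteristicMap (c : RelativeCWComplex j) (n : ℕ) (e : CellIndex c n) :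
    disk.{u} n ⟶ c.F.obj (n + 1) :=
  (c.attachCells n (not_isMax n)).cell e

/-- The relative CW-complex `j : A → Y` over `B` (via `p : Y → B`) is obtained by attaching to
`A_{n-1}`, for every `n ≥ 0`, exactly one `n`-cell for every commutative square
```
S^{n-1} ---> A_{n-1}
  |            |
  v            v
 D^n -------> B
```
where the top of the square is the attaching map of the corresponding cell, and
the bottom of the square is the map from this cell to `B`. -/
structure CellPerSquare (c : RelativeCWComplex j) (p : Y ⟶ B) where
  /-- the bijection between commutative squares and `n`-cells -/
  cellOf (n : ℕ) : Square n (stageMap c p n) ≃ CellIndex c n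
  /-- the attaching map of the cell of a square is the top of the square -/
  attachingMap_cellOf (n : ℕ) (s : Square n (stageMap c p n)) :
    attachingMap c n (cellOf n s) = s.left
  /-- the cell of a square is mapped to `B` by the bottom of the square -/
  characteristicMap_cellOf (n : ℕ) (s : Square n (stageMap c p n)) :
    characteristicMap c n (cellOf n s) ≫ stageMap c p (n + 1) = s.right

end

section

variable {A Y B A' Y' B' : TopCat.{u}} {j : A ⟶ Y} {p : Y ⟶ B} {j' : A' ⟶ Y'} {p' : Y' ⟶ B'}
  (c : RelativeCWComplex j) (c' : RelativeCWComplex j')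

/-- Let `a : A → A'`, `y : Y → Y'`, `b : B → B'` be compatible with `j, p, j', p'`. Then
`StageMaps c c' a y` is a sequence of maps `A_{n-1} → A'_{n-1}` which starts
with `a` and has colimit `y`. -/
structure StageMaps (a : A ⟶ A') (y : Y ⟶ Y') where
  /-- the maps `A_{n-1} → A'_{n-1}` -/
  map : c.F ⟶ c'.F
  map_zero : c.isoBot.inv ≫ map.app 0 = a ≫ c'.isoBot.inv
  map_incl (n : ℕ) : map.app n ≫ c'.incl.app n = c.incl.app n ≫ y

variable {c c'} {a : A ⟶ A'} {y : Y ⟶ Y'} {b : B ⟶ B'}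

/-- The square with right side `A'_{n-1} → B'` obtained from a square with right side
`A_{n-1} → B` by composing with `A_{n-1} → A'_{n-1}` and `B → B'`. -/
def StageMaps.mapSquare (t : StageMaps c c' a y) (h : y ≫ p' = p ≫ b) (n : ℕ)
    (s : Square n (stageMap c p n)) : Square n (stageMap c' p' n) :=
  s ≫ Arrow.homMk (t.map.app n) b (by
    change t.map.app n ≫ c'.incl.app n ≫ p' = (c.incl.app n ≫ p) ≫ b
    have h₁ : (t.map.app n ≫ c'.incl.app n) ≫ p' = (c.incl.app n ≫ y) ≫ p' :=
      congrArg (fun k => k ≫ p') (t.map_incl n)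
    exact h₁.trans (congrArg (fun k => c.incl.app n ≫ k) h))

/-- The maps between the stages send the cell of each square identically to the cell of the
composed square. -/
def StageMaps.PreservesCells (t : StageMaps c c' a y) (h : y ≫ p' = p ≫ b)
    (k : CellPerSquare c p) (k' : CellPerSquare c' p') : Prop :=
  ∀ (n : ℕ) (s : Square n (stageMap c p n)),
    characteristicMap c n (k.cellOf n s) ≫ t.map.app (n + 1) =
      characteristicMap c' n (k'.cellOf n (t.mapSquare h n s))

end

/-- A functorial factorization of all maps `f : A → B` as a relative CW-complex `A → B̃` followed by
a weak homotopy equivalence `B̃ → B`. -/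
abbrev CWFactorization :=
  MorphismProperty.FunctorialFactorizationData relativeCWComplexes.{u} weakEquivalences.{u}

/-- The functorial factorization `F` is built, for every map `f : A → B`, by attaching to `A_{n-1}`
one `n`-cell for every commutative square from `S^{n-1} → D^n` to `A_{n-1} → B`
and taking the sequential colimit `B̃` of the `A_n`, and for every morphism of
maps by sending cells to the corresponding cells. -/
structure BuiltFromSquares (F : CWFactorization.{u}) where
  /-- the relative CW-complex `A → B̃`, with its skeleta and cells -/
  cw (f : Arrow TopCat.{u}) : RelativeCWComplex (F.i.app f)
  /-- there is one `n`-cell for each square -/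
  cells (f : Arrow TopCat.{u}) : CellPerSquare (cw f) (F.p.app f)
  /-- the maps `A_{n-1} → A'_{n-1}` induced by a morphism of arrows -/
  stages {f g : Arrow TopCat.{u}} (φ : f ⟶ g) : StageMaps (cw f) (cw g) φ.left (F.Z.map φ)
  preservesCells {f g : Arrow TopCat.{u}} (φ : f ⟶ g) :
    (stages φ).PreservesCells (F.p.naturality φ) (cells f) (cells g)

/-! ### Functorial CW-approximation -/

/-- The functor which sends a space `B` to the map `∅ → B`. -/
def fromEmpty : TopCat.{u} ⥤ Arrow TopCat.{u} where
  obj B := Arrow.mk (initial.to B)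
  map g := Arrow.homMk (𝟙 _) g (by simp)
  map_id B := by ext <;> rfl
  map_comp g h := by
    apply CommaMorphism.ext
    · exact (Category.comp_id _).symm
    · rfl

/-- A functor `T : Top → Top` with a natural transformation `ε : T → id` is a functorial
CW-approximation if every `T B` is a CW-complex and
every `ε_B : T B → B` is a weak homotopy equivalence. -/
def IsFunctorialCWApproximation (T : TopCat.{u} ⥤ TopCat.{u}) (ε : T ⟶ 𝟭 TopCat.{u}) : Prop :=
  ∀ B : TopCat.{u}, Nonempty (TopCat.CWComplex (T.obj B)) ∧ weakEquivalences (ε.app B)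

/-- The functor `B ↦ B̃` obtained by factoring the maps `∅ → B`. -/
def approximation (F : CWFactorization.{u}) : TopCat.{u} ⥤ TopCat.{u} := fromEmpty ⋙ F.Z

/-- The natural map `B̃ → B` obtained by factoring the maps `∅ → B`. -/
def approximationMap (F : CWFactorization.{u}) : approximation F ⟶ 𝟭 TopCat.{u} where
  app B := F.p.app (fromEmpty.obj B)
  naturality _ _ g := F.p.naturality (fromEmpty.map g)

end

end FunctorialCW

/-! The difficulty is that n-cells are attached only once, for squares whose top lies in A_{n-1},
whereas p has to lift squares whose top is an arbitrary map S^{n-1} → B̃. Cellular approximation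
reconciles the two. A compact set lies in some stage (`exists_subset_range_incl`), and the stages
after A_{n-1} only add cells of dimension m ≥ n. A map from S^{n-1} to ℝ^m can be perturbed off the
origin when m ≥ n, so the top can be pushed radially out of these cells, down to A_{n-1}
(`exists_homotopic_of_attachCells`, `exists_homotopic_incl`). A square whose top lies in A_{n-1} is
lifted strictly by the characteristic map of its own cell (`CellPerSquare.exists_lift`). Carrying
that lift back along the homotopy of the top gives a lift up to homotopy relative to S^{n-1}
(`exists_lift_of_homotopy`).

Such lifts make p a weak equivalence: for π_n, the disk D^n gives surjectivity and D^{n+1}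
injectivity.

Functoriality is formal: each stage is a pushout over the set of all squares, morphisms of arrows
carry squares to squares, and colimits are functorial. -/

namespace FunctorialCW

noncomputable section

/-! ### Topology of a cell attachment. -/

section Attach

open Metric Set

variable {X₁ X₂ : TopCat.{u}} {f : X₁ ⟶ X₂} {m : ℕ}
  (ac : AttachCells.{u} (RelativeCWComplex.basicCell.{u} m) f)

/-- The closed unit ball of the `n`-dimensional Euclidean space. -/
abbrev UnitBall (n : ℕ) : Type := closedBall (0 : EuclideanSpace ℝ (Fin n)) 1

/-- The unit sphere of the `n`-dimensional Euclidean space. -/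
abbrev UnitSphere (n : ℕ) : Type := sphere (0 : EuclideanSpace ℝ (Fin n)) 1

/-- The inclusion of the unit sphere in the closed unit ball. -/
def sphereToBall (n : ℕ) : C(UnitSphere n, UnitBall n) :=
  ⟨fun s => ⟨s.1, sphere_subset_closedBall s.2⟩, by fun_prop⟩

/-- The continuous map underlying the attaching map of a cell. -/
def attach (i : ac.ι) : C(UnitSphere m, X₁) :=
  (ac.cofan₁.inj i ≫ ac.g₁).hom.comp ⟨ULift.up, continuous_uliftUp⟩

/-- The continuous map underlying the characteristic map of a cell. -/
def charMap (i : ac.ι) : C(UnitBall m, X₂) :=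
  (ac.cell i).hom.comp ⟨ULift.up, continuous_uliftUp⟩

lemma charMap_sphereToBall (i : ac.ι) (s : UnitSphere m) :
    charMap ac i (sphereToBall m s) = f (attach ac i s) := by
  have h := ac.isPushout.w
  have h' : (ac.cofan₁.inj i ≫ ac.g₁) ≫ f = diskBoundaryInclusion m ≫ ac.cell i := by
    rw [Category.assoc, h, ac.hm_assoc]; rfl
  exact (congrArg (fun k => k (ULift.up s)) h').symm

lemma exists_desc {Z : Type u} [TopologicalSpace Z] (h : C(X₁, Z)) (g : ac.ι → C(UnitBall m, Z))
    (hg : ∀ i s, g i (sphereToBall m s) = h (attach ac i s)) :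
    ∃ k : C(X₂, Z), (∀ x, k (f x) = h x) ∧ ∀ i u, k (charMap ac i u) = g i u := by
  let g' (i : ac.ι) : disk.{u} m ⟶ TopCat.of Z :=
    TopCat.ofHom ((g i).comp ⟨ULift.down, continuous_uliftDown⟩)
  let d : ac.cofan₂.pt ⟶ TopCat.of Z := Cofan.IsColimit.desc ac.isColimit₂ g'
  have hd (i : ac.ι) : ac.cofan₂.inj i ≫ d = g' i := Cofan.IsColimit.fac ac.isColimit₂ g' i
  have w : ac.g₁ ≫ TopCat.ofHom h = ac.m ≫ d := by
    refine Cofan.IsColimit.hom_ext ac.isColimit₁ _ _ fun i => ?_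
    rw [ac.hm_assoc, hd]
    ext s
    exact (hg i s.down).symm
  refine ⟨(ac.isPushout.desc (TopCat.ofHom h) d w).hom, fun x => ?_, fun i u => ?_⟩
  · exact congrArg (fun k => k x) (ac.isPushout.inl_desc (TopCat.ofHom h) d w)
  · have : ac.cell i ≫ ac.isPushout.desc (TopCat.ofHom h) d w = g' i := by
      rw [ac.cell_def, Category.assoc, ac.isPushout.inr_desc, hd]
    exact congrArg (fun k => k (ULift.up u)) this

/-- Lets `Prop`, ℝ and Euclidean spaces serve as targets, by lifting them to the universe `u`. -/
lemma exists_desc_of_type {Z : Type} [TopologicalSpace Z] (h : C(X₁, Z))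
    (g : ac.ι → C(UnitBall m, Z)) (hg : ∀ i s, g i (sphereToBall m s) = h (attach ac i s)) :
    ∃ k : C(X₂, Z), (∀ x, k (f x) = h x) ∧ ∀ i u, k (charMap ac i u) = g i u := by
  let e : C(Z, ULift.{u} Z) := ⟨ULift.up, continuous_uliftUp⟩
  obtain ⟨k, hk, hk'⟩ := exists_desc ac (e.comp h) (fun i => e.comp (g i))
    (fun i s => congrArg e (hg i s))
  refine ⟨(⟨ULift.down, continuous_uliftDown⟩ : C(ULift.{u} Z, Z)).comp k, fun x => ?_,
    fun i u => ?_⟩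
  · exact congrArg ULift.down (hk x)
  · exact congrArg ULift.down (hk' i u)

lemma mem_range_or_exists_charMap_eq (y : X₂) : (∃ x, f x = y) ∨ ∃ i u, charMap ac i u = y := by
  by_contra hy
  simp only [not_or, not_exists] at hy
  -- Into an indiscrete space every function is continuous. If `y` were missed, its indicator and
  -- the constant `False` would agree on `X₁` and on all cells, hence everywhere.
  let Z : TopCat.{u} := @TopCat.of (ULift.{u} Prop) ⊤
  let φ : X₂ ⟶ Z := @TopCat.ofHom _ _ _ ⊤ (@ContinuousMap.mk _ _ _ ⊤ (fun z => ⟨z = y⟩)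
    continuous_top)
  let ψ : X₂ ⟶ Z := @TopCat.ofHom _ _ _ ⊤ (@ContinuousMap.mk _ _ _ ⊤ (fun _ => ⟨False⟩)
    continuous_top)
  have h : φ = ψ := by
    refine ac.hom_ext ?_ fun i => ?_
    · ext x : 1
      exact congrArg ULift.up (eq_false (hy.1 x))
    · ext u : 1
      exact congrArg ULift.up (eq_false (hy.2 i u.down))
  have := congrArg ULift.down (congrArg (fun k : X₂ ⟶ Z => k y) h)
  exact this.mp rfl

/-- The points of the ball which are radially projected to a subset of the sphere. -/
def radialSet (S : Set (UnitSphere m)) : Set (UnitBall m) :=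
  {u | ∃ h : (u : EuclideanSpace ℝ (Fin m)) ≠ 0,
    (⟨‖u.1‖⁻¹ • u.1, by simp [norm_smul, h]⟩ : UnitSphere m) ∈ S}

lemma isOpen_radialSet {S : Set (UnitSphere m)} (hS : IsOpen S) : IsOpen (radialSet S) := by
  let U : Set (UnitBall m) := {u | (u : EuclideanSpace ℝ (Fin m)) ≠ 0}
  have hU : IsOpen U := isOpen_ne_fun continuous_subtype_val continuous_const
  let q : U → UnitSphere m := fun u => ⟨‖u.1.1‖⁻¹ • u.1.1, by
    rw [mem_sphere_zero_iff_norm, norm_smul, norm_inv, norm_norm,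
      inv_mul_cancel₀ (norm_ne_zero_iff.2 u.2)]⟩
  have hq : Continuous q := by
    refine Continuous.subtype_mk ?_ _
    have h : Continuous fun u : U => u.1.1 := by fun_prop
    exact (h.norm.inv₀ fun u => norm_ne_zero_iff.2 u.2).smul h
  have : radialSet S = Subtype.val '' (q ⁻¹' S) := by
    ext u
    constructor
    · rintro ⟨h, hu⟩
      exact ⟨⟨u, h⟩, hu, rfl⟩
    · rintro ⟨v, hv, rfl⟩
      exact ⟨v.2, hv⟩
  rw [this]
  exact hU.isOpenMap_subtype_val _ (hS.preimage hq)

/-- Allows a subset of `X₁` to be extended over the cells: its preimage under each attaching map is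
thickened radially. -/
lemma sphereToBall_mem_radialSet (S : Set (UnitSphere m)) (s : UnitSphere m) :
    sphereToBall m s ∈ radialSet S ↔ s ∈ S := by
  have hs : ‖s.1‖ = 1 := mem_sphere_zero_iff_norm.1 s.2
  have h0 : s.1 ≠ 0 := by
    intro h
    simp [h] at hs
  have : (⟨‖s.1‖⁻¹ • s.1, by simp⟩ : UnitSphere m) = s := by
    ext1
    simp [hs]
  constructor
  · rintro ⟨_, h⟩
    rwa [← this]
  · intro h
    refine ⟨h0, ?_⟩
    change (⟨‖s.1‖⁻¹ • s.1, _⟩ : UnitSphere m) ∈ S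
    rwa [this]

include ac in
-- The indicator of a point of `X₁`, valued in an indiscrete space, extends over the cells and so
-- separates images.
lemma attachCells_injective : Function.Injective f := by
  intro x x' hx
  let Z : Type u := ULift.{u} Prop
  let : TopologicalSpace Z := ⊤
  obtain ⟨k, hk, -⟩ := exists_desc ac (Z := Z) ⟨fun z => ⟨z = x'⟩, continuous_top⟩
    (fun i => ⟨fun u => ⟨u ∈ radialSet (attach ac i ⁻¹' {x'})⟩, continuous_top⟩)
    (fun i s => congrArg ULift.up (propext (sphereToBall_mem_radialSet _ s)))
  have := (hk x).symm.trans ((congrArg k hx).trans (hk x'))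
  exact (congrArg ULift.down this).mpr rfl

include ac in
-- Open sets are continuous maps to the Sierpiński space `Prop`; radial thickening extends such a
-- map from `X₁` to `X₂`.
lemma attachCells_isInducing : Topology.IsInducing f := by
  refine ⟨le_antisymm f.hom.continuous.le_induced fun U hU => ?_⟩
  obtain ⟨k, hk, -⟩ := exists_desc_of_type ac (Z := Prop)
    ⟨fun z => z ∈ U, continuous_Prop.2 hU⟩
    (fun i => ⟨fun u => u ∈ radialSet (attach ac i ⁻¹' U),
      continuous_Prop.2 (isOpen_radialSet (hU.preimage (attach ac i).continuous))⟩)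
    (fun i s => propext (sphereToBall_mem_radialSet _ s))
  refine ⟨{y | k y}, continuous_Prop.1 k.continuous, ?_⟩
  ext x
  exact iff_of_eq (hk x)

/-- The norm is 1 on the attaching spheres, so it glues with the constant 1. -/
lemma exists_radius : ∃ r : C(X₂, ℝ), (∀ x, r (f x) = 1) ∧ ∀ i u, r (charMap ac i u) = ‖u.1‖ :=
  exists_desc_of_type ac (ContinuousMap.const _ 1) (fun _ => ⟨fun u => ‖u.1‖, by fun_prop⟩)
    (fun _ s => mem_sphere_zero_iff_norm.1 s.2)

lemma charMap_mem_range (i : ac.ι) (u : UnitBall m) (hu : ‖u.1‖ = 1) :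
    charMap ac i u ∈ range f :=
  ⟨attach ac i ⟨u.1, by simpa using hu⟩, (charMap_sphereToBall ac i ⟨u.1, by simpa using hu⟩).symm⟩

include ac in
/-- A space is a closed subspace of a space obtained by attaching cells, and the zero set of a
continuous function. -/
lemma exists_radius_lt_one : ∃ r : C(X₂, ℝ), (∀ x, r (f x) = 1) ∧ ∀ y ∉ range f, r y < 1 := by
  obtain ⟨r, h₁, h₂⟩ := exists_radius ac
  refine ⟨r, h₁, fun y hy => ?_⟩
  obtain ⟨x, rfl⟩ | ⟨i, u, rfl⟩ := mem_range_or_exists_charMap_eq ac y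
  · exact absurd (mem_range_self x) hy
  · rw [h₂]
    refine lt_of_le_of_ne (mem_closedBall_zero_iff.1 u.2) fun h => hy (charMap_mem_range ac i u h)

include ac in
lemma attachCells_isClosedEmbedding : Topology.IsClosedEmbedding f := by
  refine ⟨⟨attachCells_isInducing ac, attachCells_injective ac⟩, ?_⟩
  obtain ⟨r, h₁, h₂⟩ := exists_radius_lt_one ac
  have : range f = r ⁻¹' {1} := by
    ext y
    refine ⟨?_, fun h => ?_⟩
    · rintro ⟨x, rfl⟩
      exact h₁ x
    · by_contra hy
      exact (h₂ y hy).ne h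
  rw [this]
  exact isClosed_singleton.preimage r.continuous

end Attach

/-! ### Pushing maps out of the attached cells. -/

section Compression

open Metric Set
open scoped unitInterval

/-- The continuous maps from `K` to the `m`-dimensional Euclidean space can be approximated by
maps which avoid the origin. -/
def AvoidsOrigin (K : Type*) [TopologicalSpace K] (m : ℕ) : Prop :=
  ∀ (w : C(K, EuclideanSpace ℝ (Fin m))) (ε : ℝ), 0 < ε →
    ∃ g : C(K, EuclideanSpace ℝ (Fin m)), (∀ z, ‖g z - w z‖ < ε) ∧ ∀ z, g z ≠ 0

/-- The truncation of a vector to the closed unit ball. -/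
def truncate {m : ℕ} (x : EuclideanSpace ℝ (Fin m)) : UnitBall m :=
  ⟨(max 1 ‖x‖)⁻¹ • x, by
    rw [mem_closedBall_zero_iff, norm_smul, norm_inv, Real.norm_eq_abs,
      abs_of_pos (lt_max_of_lt_left one_pos)]
    exact inv_mul_le_one_of_le₀ (le_max_right _ _) (zero_le_one.trans (le_max_left _ _))⟩

@[fun_prop]
lemma continuous_truncate {m : ℕ} : Continuous (truncate (m := m)) := by
  have h : Continuous fun x : EuclideanSpace ℝ (Fin m) => max 1 ‖x‖ :=
    continuous_const.max continuous_norm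
  exact ((h.inv₀ fun x => (lt_max_of_lt_left one_pos).ne').smul continuous_id).subtype_mk _

lemma truncate_of_norm_le {m : ℕ} (x : UnitBall m) : truncate x.1 = x := by
  ext1
  simp [truncate, max_eq_left (mem_closedBall_zero_iff.1 x.2)]

lemma truncate_smul {m : ℕ} (x : EuclideanSpace ℝ (Fin m)) (hx : ‖x‖ = 1) {c : ℝ} (hc : 1 ≤ c) :
    (truncate (c • x)).1 = x := by
  have hc' : 0 < c := one_pos.trans_le hc
  simp [truncate, norm_smul, hx, abs_of_pos hc', max_eq_right hc, smul_smul, hc'.ne']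

lemma norm_truncate {m : ℕ} (x : EuclideanSpace ℝ (Fin m)) (hx : 1 ≤ ‖x‖) :
    ‖(truncate x).1‖ = 1 := by
  simp only [truncate, max_eq_right hx, norm_smul, norm_inv, norm_norm]
  exact inv_mul_cancel₀ (by positivity)

/-- A function which is `1` on the ball of radius `1 / 2` and vanishes on the unit sphere. -/
def cutoff {m : ℕ} (u : UnitBall m) : ℝ := min 1 (2 - 2 * ‖u.1‖)

@[fun_prop]
lemma continuous_cutoff {m : ℕ} : Continuous (cutoff (m := m)) := by
  unfold cutoff
  fun_prop

lemma cutoff_of_norm_eq_one {m : ℕ} {u : UnitBall m} (hu : ‖u.1‖ = 1) : cutoff u = 0 := by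
  simp [cutoff, hu]

lemma norm_sphereToBall {m : ℕ} (s : UnitSphere m) : ‖(sphereToBall m s).1‖ = 1 :=
  mem_sphere_zero_iff_norm.1 s.2

/-- A map from the ball to the Euclidean space which is the identity near the origin and
vanishes on the unit sphere. -/
def bump (m : ℕ) : C(UnitBall m, EuclideanSpace ℝ (Fin m)) :=
  ⟨fun u => cutoff u • u.1, by fun_prop⟩

lemma bump_sphereToBall {m : ℕ} (s : UnitSphere m) : bump m (sphereToBall m s) = 0 := by
  change cutoff (sphereToBall m s) • (sphereToBall m s).1 = 0
  rw [cutoff_of_norm_eq_one (norm_sphereToBall s), zero_smul]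

lemma cutoff_of_norm_le {m : ℕ} {u : UnitBall m} (hu : ‖u.1‖ ≤ 1 / 2) : cutoff u = 1 :=
  min_eq_left (by linarith)

lemma abs_cutoff_le {m : ℕ} (u : UnitBall m) : |cutoff u| ≤ 1 := by
  have := mem_closedBall_zero_iff.1 u.2
  exact abs_le.2 ⟨le_min (by norm_num) (by linarith), min_le_left _ _⟩

/-- A deformation of the ball relative to its boundary: translation by `v` near
the origin followed by a radial expansion. -/
def pushOut {m : ℕ} (M : ℝ) (t : ℝ) (v : EuclideanSpace ℝ (Fin m)) (u : UnitBall m) :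
    UnitBall m :=
  truncate ((1 + t * M) • (u.1 + (t * cutoff u) • v))

lemma pushOut_zero {m : ℕ} (M : ℝ) (v : EuclideanSpace ℝ (Fin m)) (u : UnitBall m) :
    pushOut M 0 v u = u := by
  simp [pushOut, truncate_of_norm_le]

lemma pushOut_of_norm_eq_one {m : ℕ} {M t : ℝ} (hM : 0 ≤ M) (ht : 0 ≤ t)
    (v : EuclideanSpace ℝ (Fin m)) {u : UnitBall m} (hu : ‖u.1‖ = 1) : pushOut M t v u = u := by
  ext1
  rw [pushOut, cutoff_of_norm_eq_one hu, mul_zero, zero_smul, add_zero,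
    truncate_smul _ hu (by nlinarith [mul_nonneg ht hM])]

/-- Within radius 1/2 the cutoff is 1 and the translated point is the vector bounded below by `hu`;
outside, a translation by at most 1/4 leaves norm at least 1/4 ≥ δ. Expansion by 1 + δ⁻¹ then
reaches norm 1, where truncation lands on the sphere. -/
lemma norm_pushOut_one {m : ℕ} {δ : ℝ} (hδ : 0 < δ) (hδ' : δ ≤ 1 / 4)
    {v : EuclideanSpace ℝ (Fin m)} (hv : ‖v‖ ≤ 1 / 4) {u : UnitBall m}
    (hu : δ ≤ ‖cutoff u • u.1 + v‖) : ‖(pushOut δ⁻¹ 1 v u).1‖ = 1 := by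
  have key : δ ≤ ‖u.1 + cutoff u • v‖ := by
    by_cases h : ‖u.1‖ ≤ 1 / 2
    · simpa [cutoff_of_norm_le h] using hu
    · have h₁ : ‖cutoff u • v‖ ≤ 1 / 4 := by
        rw [norm_smul, Real.norm_eq_abs]
        nlinarith [abs_cutoff_le u, norm_nonneg v, abs_nonneg (cutoff u)]
      have h₂ := norm_sub_norm_le u.1 (-(cutoff u • v))
      rw [sub_neg_eq_add, norm_neg] at h₂
      linarith
  refine norm_truncate _ ?_
  rw [one_mul, one_mul, norm_smul, Real.norm_eq_abs, abs_of_pos (by positivity)]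
  calc 1 = δ⁻¹ * δ := (inv_mul_cancel₀ hδ.ne').symm
    _ ≤ (1 + δ⁻¹) * ‖u.1 + cutoff u • v‖ := by gcongr; linarith

variable {X₁ X₂ : TopCat.{u}} {f : X₁ ⟶ X₂} {m : ℕ}
  (ac : AttachCells.{u} (RelativeCWComplex.basicCell.{u} m) f)

/-- The parameter is curried because the universal property of the attachment only produces maps out
of `X₂`, not out of `V × X₂`. -/
lemma exists_deformation {V : Type} [TopologicalSpace V] (D : C(V × UnitBall m, UnitBall m))
    (hD : ∀ v s, D (v, sphereToBall m s) = sphereToBall m s) :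
    ∃ Φ : C(X₂, C(V, X₂)), (∀ x v, Φ (f x) v = f x) ∧
      ∀ i u v, Φ (charMap ac i u) v = charMap ac i (D (v, u)) := by
  let D' : C(UnitBall m, C(V, UnitBall m)) := (D.comp ContinuousMap.prodSwap).curry
  obtain ⟨Φ, h₁, h₂⟩ := exists_desc ac (Z := C(V, X₂))
    ⟨fun x => ContinuousMap.const V (f x), ContinuousMap.continuous_const'.comp f.hom.continuous⟩
    (fun i => ⟨fun u => (charMap ac i).comp (D' u),
      (ContinuousMap.continuous_postcomp _).comp D'.continuous⟩) (fun i s => by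
        ext v
        change charMap ac i (D (v, sphereToBall m s)) = f (attach ac i s)
        rw [hD, charMap_sphereToBall])
  refine ⟨Φ, fun x v => ?_, fun i u v => ?_⟩
  · rw [h₁]; rfl
  · rw [h₂]; rfl

include ac in
/-- A map to a space obtained by attaching `m`-cells can be deformed to the original space, if the
maps from its source to the Euclidean space generically avoid the origin. -/
lemma exists_homotopic_of_attachCells {K : Type*} [TopologicalSpace K] [CompactSpace K]
    (hK : AvoidsOrigin K m) (φ : C(K, X₂)) :
    ∃ φ' : C(K, X₁), φ.Homotopic (f.hom.comp φ') := by
  obtain ⟨w, -, hw⟩ := exists_desc_of_type ac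
    (ContinuousMap.const X₁ (0 : EuclideanSpace ℝ (Fin m))) (fun _ => bump m)
    (fun _ s => bump_sphereToBall s)
  obtain ⟨g, hg, hg₀⟩ := hK (w.comp φ) (1 / 4) (by norm_num)
  obtain ⟨δ, hδ, hδ', hgδ⟩ : ∃ δ : ℝ, 0 < δ ∧ δ ≤ 1 / 4 ∧ ∀ z, δ ≤ ‖g z‖ := by
    obtain ⟨δ, hδ, h⟩ := (isCompact_univ (X := K)).exists_forall_le' (f := fun z => ‖g z‖)
      g.continuous.norm.continuousOn (a := 0) (fun z _ => norm_pos_iff.2 (hg₀ z))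
    exact ⟨min δ (1 / 4), lt_min hδ (by norm_num), min_le_right _ _,
      fun z => (min_le_left _ _).trans (h z (mem_univ z))⟩
  let D : C((I × EuclideanSpace ℝ (Fin m)) × UnitBall m, UnitBall m) :=
    ⟨fun p => pushOut δ⁻¹ p.1.1 p.1.2 p.2, by unfold pushOut; fun_prop⟩
  obtain ⟨Φ, hΦ₁, hΦ₂⟩ := exists_deformation ac D (fun v s =>
    pushOut_of_norm_eq_one (by positivity) v.1.2.1 _ (norm_sphereToBall s))
  -- On a cell `w` is `cutoff u • u`, so adding this translation vector to it gives `g z`, of norm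
  -- at least δ.
  let H : C(I × K, X₂) := ⟨fun p => Φ (φ p.2) (p.1, g p.2 - w (φ p.2)), by fun_prop⟩
  have hH : ∀ z, H (1, z) ∈ range f := by
    intro z
    obtain ⟨x, hx⟩ | ⟨i, u, hu⟩ := mem_range_or_exists_charMap_eq ac (φ z)
    · refine ⟨x, ?_⟩
      change _ = Φ (φ z) _
      rw [← hx, hΦ₁]
    · change Φ (φ z) (1, g z - w (φ z)) ∈ _
      rw [← hu, hΦ₂]
      refine charMap_mem_range ac i _ (norm_pushOut_one hδ hδ' ?_ ?_)
      · rw [hu]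
        exact (hg z).le
      · have : w (charMap ac i u) = cutoff u • u.1 := hw i u
        dsimp only
        rw [this, add_sub_cancel]
        exact hgδ z
  choose φ' hφ' using hH
  refine ⟨⟨φ', (attachCells_isInducing ac).continuous_iff.2 ?_⟩, ⟨⟨H, fun z => ?_, fun z => ?_⟩⟩⟩
  · have : f ∘ φ' = fun z => H (1, z) := funext hφ'
    rw [this]
    fun_prop
  · obtain ⟨x, hx⟩ | ⟨i, u, hu⟩ := mem_range_or_exists_charMap_eq ac (φ z)
    · change Φ (φ z) _ = _
      rw [← hx, hΦ₁]
    · change Φ (φ z) _ = _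
      rw [← hu, hΦ₂]
      exact congrArg _ (pushOut_zero _ _ _)
  · exact (hφ' z).symm

end Compression

/-! ### General position for maps from spheres. -/

section Approximation

open Metric Set MeasureTheory

/-- A missed value close to the origin is translated to the origin. -/
lemma avoidsOrigin_of_dense {K : Type*} [TopologicalSpace K] {m : ℕ}
    (hK : ∀ (w : C(K, EuclideanSpace ℝ (Fin m))) (ε : ℝ), 0 < ε →
      ∃ g : C(K, EuclideanSpace ℝ (Fin m)), (∀ z, ‖g z - w z‖ < ε) ∧ Dense (range g)ᶜ) :
    AvoidsOrigin K m := by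
  intro w ε hε
  obtain ⟨g, hg, hd⟩ := hK w (ε / 2) (half_pos hε)
  obtain ⟨q, hq, hq'⟩ := hd.exists_dist_lt 0 (half_pos hε)
  refine ⟨⟨fun z => g z - q, by fun_prop⟩, fun z => ?_, fun z h => hq ⟨z, sub_eq_zero.1 h⟩⟩
  change ‖g z - q - w z‖ < ε
  have : g z - q - w z = (g z - w z) - q := by abel
  rw [this]
  rw [dist_zero_left] at hq'
  linarith [norm_sub_le (g z - w z) q, hg z]

/-- For n = m the sphere is null and differentiable maps preserve null sets; for n < m already the
image of ℝ^n has dense complement. -/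
lemma dense_compl_image_sphere {n m : ℕ} (hnm : n ≤ m)
    {g : EuclideanSpace ℝ (Fin n) → EuclideanSpace ℝ (Fin m)} (hg : ContDiff ℝ 1 g) :
    Dense (g '' sphere 0 1)ᶜ := by
  obtain rfl | h := hnm.eq_or_lt
  · refine Measure.dense_of_ae (μ := volume) (p := fun x => x ∉ g '' sphere 0 1) ?_
    refine measure_eq_zero_iff_ae_notMem.1 ?_
    exact addHaar_image_eq_zero_of_differentiableOn_of_addHaar_eq_zero _
      (hg.differentiable one_ne_zero).differentiableOn
      (Measure.addHaar_sphere_of_ne_zero _ _ one_ne_zero)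
  · refine (hg.dense_compl_range_of_finrank_lt_finrank (by simpa using h)).mono ?_
    exact compl_subset_compl.2 (image_subset_range _ _)

/-- Tietze extension to ℝ^n makes C¹ approximation available. -/
lemma avoidsOrigin_sphere {n m : ℕ} (hnm : n ≤ m) : AvoidsOrigin (UnitSphere n) m := by
  refine avoidsOrigin_of_dense fun w ε hε => ?_
  obtain ⟨w', hw'⟩ := ContinuousMap.exists_restrict_eq isClosed_sphere w
  obtain ⟨g, hg, hg', -⟩ := w'.continuous.exists_contDiff_approx 1
    (ε := fun _ => ε) continuous_const (fun _ => hε)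
  refine ⟨⟨fun s => g s.1, hg.continuous.comp continuous_subtype_val⟩, fun z => ?_, ?_⟩
  · have h := hg' z.1
    rw [dist_eq_norm] at h
    rw [← hw']
    exact h
  · have : range (fun s : UnitSphere n => g s.1) = g '' sphere 0 1 := by
      rw [image_eq_range]
    change Dense (range (fun s : UnitSphere n => g s.1))ᶜ
    rw [this]
    exact dense_compl_image_sphere hnm hg

end Approximation

/-! ### Compact sets and cellular approximation in relative CW-complexes. -/

section Skeleta

open Metric Set

variable {X Y : TopCat.{u}} {j : X ⟶ Y} (c : RelativeCWComplex j)

lemma isClosedEmbedding_map {m n : ℕ} (h : m ≤ n) :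
    Topology.IsClosedEmbedding (c.F.map (homOfLE h)) := by
  induction n, h using Nat.le_induction with
  | base =>
    rw [show homOfLE (le_refl m) = 𝟙 m from rfl, c.F.map_id]
    exact Topology.IsClosedEmbedding.id
  | succ n h ih =>
    rw [← homOfLE_comp h (Nat.le_succ n), c.F.map_comp, TopCat.coe_comp]
    exact (attachCells_isClosedEmbedding (c.attachCells n (not_isMax n))).comp ih

lemma incl_map {m n : ℕ} (h : m ≤ n) (x : c.F.obj m) :
    c.incl.app n (c.F.map (homOfLE h) x) = c.incl.app m x := by
  have := c.incl.naturality (homOfLE h)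
  exact congrArg (fun k => k x) this

lemma incl_injective (n : ℕ) : Function.Injective (c.incl.app n) := by
  intro x y hxy
  have hc := isColimitOfPreserves (forget TopCat) c.isColimit
  obtain ⟨k, f, g, h⟩ := (Types.FilteredColimit.isColimit_eq_iff _ hc (i := n) (j := n)
    (xi := x) (xj := y)).1 hxy
  obtain rfl : f = g := Subsingleton.elim _ _
  exact (isClosedEmbedding_map c (leOfHom f)).injective h

lemma exists_incl_eq (y : Y) : ∃ n x, c.incl.app n x = y := by
  have hc := isColimitOfPreserves (forget TopCat) c.isColimit
  obtain ⟨n, x, hx⟩ := Types.jointly_surjective _ hc y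
  exact ⟨n, x, hx⟩

lemma isClosed_iff_preimage_incl (S : Set Y) :
    IsClosed S ↔ ∀ n, IsClosed (c.incl.app n ⁻¹' S) :=
  TopCat.isClosed_iff_of_isColimit _ c.isColimit S

lemma isClosedEmbedding_incl (n : ℕ) : Topology.IsClosedEmbedding (c.incl.app n) := by
  refine .of_continuous_injective_isClosedMap (c.incl.app n).hom.continuous (incl_injective c n)
    fun T hT => ?_
  rw [isClosed_iff_preimage_incl c]
  intro m
  obtain h | h := le_total m n
  · convert! hT.preimage (c.F.map (homOfLE h)).hom.continuous using 1
    ext x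
    rw [mem_preimage, ← incl_map c h, (incl_injective c n).mem_set_image]
    rfl
  · convert! (isClosedEmbedding_map c h).isClosedMap _ hT using 1
    ext x
    simp only [mem_preimage, mem_image, ← incl_map c h, (incl_injective c m).eq_iff]

lemma range_incl_subset {m n : ℕ} (h : m ≤ n) : range (c.incl.app m) ⊆ range (c.incl.app n) := by
  rintro _ ⟨x, rfl⟩
  exact ⟨_, incl_map c h x⟩

/-- A point in the complement of the `n`th stage belongs to a closed subset which is disjoint from
it. -/
lemma exists_isClosed_disjoint {n : ℕ} {y : Y} (hy : y ∉ range (c.incl.app n)) :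
    ∃ S, IsClosed S ∧ y ∈ S ∧ Disjoint S (range (c.incl.app n)) := by
  obtain ⟨k, hk, hk'⟩ : ∃ k, y ∉ range (c.incl.app k) ∧ y ∈ range (c.incl.app (k + 1)) ∧ n ≤ k := by
    by_contra! h
    have : ∀ k, n ≤ k → y ∉ range (c.incl.app k) := by
      intro k hk
      induction k, hk using Nat.le_induction with
      | base => exact hy
      | succ k hk ih => exact fun h' => absurd (h k ih h') hk.not_gt
    obtain ⟨l, x, hx⟩ := exists_incl_eq c y
    exact this (max n l) (le_max_left _ _) (range_incl_subset c (le_max_right _ _) ⟨x, hx⟩)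
  obtain ⟨⟨x, rfl⟩, hnk⟩ := hk'
  obtain ⟨r, hr₁, hr₂⟩ := exists_radius_lt_one (c.attachCells k (not_isMax k))
  have hx : r x < 1 := by
    refine hr₂ x ?_
    rintro ⟨z, rfl⟩
    exact hk ⟨z, (incl_map c (Nat.le_succ k) z).symm⟩
  -- On this set `r ≤ r x < 1`, while `r = 1` on stage `k`, which contains stage `n`.
  refine ⟨c.incl.app (k + 1) '' (r ⁻¹' Iic (r x)),
    (isClosedEmbedding_incl c _).isClosedMap _ (isClosed_Iic.preimage r.continuous),
    mem_image_of_mem _ (le_refl (r x)), ?_⟩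
  rw [Set.disjoint_left]
  rintro _ ⟨z, hz, rfl⟩ ⟨t, ht⟩
  rw [← incl_map c hnk, ← incl_map c (Nat.le_succ k)] at ht
  have := incl_injective c _ ht
  rw [← this] at hz
  have h1 := hr₁ (c.F.map (homOfLE hnk) t)
  exact absurd (h1.symm.le.trans hz) hx.not_ge

/-- A compact subset of a relative CW-complex is contained in one of its stages. -/
lemma exists_subset_range_incl {K : Set Y} (hK : IsCompact K) :
    ∃ n, K ⊆ range (c.incl.app n) := by
  by_contra! h
  have step (n : ℕ) : ∃ S, IsClosed S ∧ (K ∩ S).Nonempty ∧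
      Disjoint S (range (c.incl.app n)) := by
    obtain ⟨y, hyK, hy⟩ := not_subset.1 (h n)
    obtain ⟨S, hS, hyS, hd⟩ := exists_isClosed_disjoint c hy
    exact ⟨S, hS, ⟨y, hyK, hyS⟩, hd⟩
  choose S hSc hSn hSd using step
  -- Stage `l` meets `S n` only for `n < l`, so these tails are closed and decrease to ∅;
  -- compactness makes one of them miss `K`.
  let T (k : ℕ) : Set Y := ⋃ n, ⋃ (_ : k ≤ n), S n
  have hT (k : ℕ) : IsClosed (T k) := by
    rw [isClosed_iff_preimage_incl c]
    intro l
    have : c.incl.app l ⁻¹' T k = ⋃ n ∈ Finset.Ico k l, c.incl.app l ⁻¹' S n := by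
      ext x
      simp only [T, mem_preimage, mem_iUnion, Finset.mem_Ico, exists_prop]
      refine ⟨fun ⟨n, hn, hx⟩ => ⟨n, ⟨hn, ?_⟩, hx⟩, fun ⟨n, hn, hx⟩ => ⟨n, hn.1, hx⟩⟩
      by_contra! hl
      exact Set.disjoint_left.1 (hSd n) hx (range_incl_subset c hl (mem_range_self x))
    rw [this]
    exact isClosed_biUnion_finset fun n _ => (hSc n).preimage (c.incl.app l).hom.continuous
  obtain ⟨k, hk⟩ := hK.elim_directed_family_closed T hT (by
    refine eq_empty_of_forall_notMem fun y ⟨_, hy⟩ => ?_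
    obtain ⟨l, x, rfl⟩ := exists_incl_eq c y
    obtain ⟨n, hn, hx⟩ := mem_iUnion₂.1 (mem_iInter.1 hy l)
    exact Set.disjoint_left.1 (hSd n) hx (range_incl_subset c hn (mem_range_self x)))
    (directed_of_isDirected_le fun k l hkl =>
      iUnion₂_mono' fun n hn => ⟨n, hkl.trans hn, subset_rfl⟩)
  obtain ⟨y, hy, hy'⟩ := hSn k
  exact hk.le ⟨hy, mem_iUnion₂.2 ⟨k, le_rfl, hy'⟩⟩

variable {K : Type*} [TopologicalSpace K] [CompactSpace K]

lemma exists_factor_incl (φ : C(K, Y)) :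
    ∃ n, ∃ ψ : C(K, c.F.obj n), φ = (c.incl.app n).hom.comp ψ := by
  obtain ⟨n, hn⟩ := exists_subset_range_incl c (isCompact_range φ.continuous)
  choose ψ hψ using fun z => hn (mem_range_self z)
  refine ⟨n, ⟨ψ, (isClosedEmbedding_incl c n).isInducing.continuous_iff.2 ?_⟩, ?_⟩
  · exact φ.continuous.congr fun z => (hψ z).symm
  · ext z
    exact (hψ z).symm

/-- Stage `m + 1` arises from stage `m` by attaching `m`-cells, so descending to stage `n` only
meets dimensions ≥ `n`. -/
lemma exists_homotopic_incl_aux (n : ℕ) (hK : ∀ m, n ≤ m → AvoidsOrigin K m) {m : ℕ} (h : n ≤ m)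
    (ψ : C(K, c.F.obj m)) : ∃ ψ' : C(K, c.F.obj n),
      ((c.incl.app m).hom.comp ψ).Homotopic ((c.incl.app n).hom.comp ψ') := by
  induction m, h using Nat.le_induction with
  | base => exact ⟨ψ, .refl _⟩
  | succ m h ih =>
    obtain ⟨φ, hφ⟩ := exists_homotopic_of_attachCells (c.attachCells m (not_isMax m)) (hK m h) ψ
    obtain ⟨ψ', hψ'⟩ := ih φ
    refine ⟨ψ', .trans ?_ hψ'⟩
    have : (c.incl.app m).hom.comp φ = (c.incl.app (m + 1)).hom.comp
        ((c.F.map (homOfLE (Nat.le_succ m))).hom.comp φ) := by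
      ext z
      exact (incl_map c (Nat.le_succ m) (φ z)).symm
    rw [this]
    exact (ContinuousMap.Homotopic.refl (c.incl.app (m + 1)).hom).comp hφ

/-- Maps from a compact space of small dimension to a relative CW-complex can be deformed to a low
dimensional skeleton. -/
lemma exists_homotopic_incl (n : ℕ) (hK : ∀ m, n ≤ m → AvoidsOrigin K m) (φ : C(K, Y)) :
    ∃ ψ : C(K, c.F.obj n), φ.Homotopic ((c.incl.app n).hom.comp ψ) := by
  obtain ⟨m, ψ, rfl⟩ := exists_factor_incl c φ
  obtain h | h := le_total n m
  · exact exists_homotopic_incl_aux c n hK h ψ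
  · refine ⟨(c.F.map (homOfLE h)).hom.comp ψ, ?_⟩
    have : (c.incl.app n).hom.comp ((c.F.map (homOfLE h)).hom.comp ψ) =
        (c.incl.app m).hom.comp ψ := by
      ext z
      exact incl_map c h (ψ z)
    rw [this]

end Skeleta

/-! ### Transporting lifts along a homotopy of the boundary. -/

section Lifting

open Metric Set
open scoped unitInterval

/-- Gluing a map on the unit ball and a homotopy on the unit sphere to a map on the ball of
radius `2`. -/
lemma exists_glue {Z : Type*} [TopologicalSpace Z] {n : ℕ} (a : C(UnitBall n, Z))
    (b : C(I × UnitSphere n, Z)) (hab : ∀ s, a (sphereToBall n s) = b (0, s)) :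
    ∃ k : C(closedBall (0 : EuclideanSpace ℝ (Fin n)) 2, Z),
      (∀ x (hx : ‖x.1‖ ≤ 1), k x = a ⟨x.1, by simpa using hx⟩) ∧
      ∀ x (t : I) (s : UnitSphere n), x.1 = (1 + t.1) • s.1 → k x = b (t, s) := by
  have hne {x : closedBall (0 : EuclideanSpace ℝ (Fin n)) 2} (hx : 1 ≤ ‖x.1‖) : ‖x.1‖ ≠ 0 :=
    (one_pos.trans_le hx).ne'
  let g (x : {x : closedBall (0 : EuclideanSpace ℝ (Fin n)) 2 // 1 ≤ ‖x.1‖}) : I × UnitSphere n :=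
    (Set.projIcc 0 1 zero_le_one (‖x.1.1‖ - 1), ⟨‖x.1.1‖⁻¹ • x.1.1, by
      rw [mem_sphere_zero_iff_norm, norm_smul, norm_inv, norm_norm, inv_mul_cancel₀ (hne x.2)]⟩)
  have hg : Continuous g := by
    have h : Continuous fun x : {x : closedBall (0 : EuclideanSpace ℝ (Fin n)) 2 // 1 ≤ ‖x.1‖} =>
      x.1.1 := by fun_prop
    exact (continuous_projIcc.comp (h.norm.sub continuous_const)).prodMk
      (((h.norm.inv₀ fun x => hne x.2).smul h).subtype_mk _)
  -- The values of `b'` at norm below 1 do not matter.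
  let b' (x : closedBall (0 : EuclideanSpace ℝ (Fin n)) 2) : Z :=
    if hx : 1 ≤ ‖x.1‖ then b (g ⟨x, hx⟩) else a (truncate x.1)
  have hg₁ (x) (hx : ‖x.1‖ = 1) : g ⟨x, hx.ge⟩ = (0, ⟨x.1, by simpa using hx⟩) := by
    simp [g, hx]
  have hb' : ContinuousOn b' {x | 1 ≤ ‖x.1‖} := by
    rw [continuousOn_iff_continuous_domRestrict]
    refine (b.continuous.comp hg).congr fun x => ?_
    have hx : 1 ≤ ‖x.1.1‖ := x.2
    simp [b', hx]
  have ha (x : closedBall (0 : EuclideanSpace ℝ (Fin n)) 2) (hx : ‖x.1‖ ≤ 1) :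
      truncate x.1 = ⟨x.1, by simpa using hx⟩ :=
    truncate_of_norm_le ⟨x.1, by simpa using hx⟩
  have hab' (x : closedBall (0 : EuclideanSpace ℝ (Fin n)) 2) (hx : ‖x.1‖ = 1) :
      a (truncate x.1) = b' x := by
    simp only [b', hx.ge, dite_true]
    rw [hg₁ x hx, ← hab, ha x hx.le]
    rfl
  refine ⟨⟨fun x => if ‖x.1‖ ≤ 1 then a (truncate x.1) else b' x,
    continuous_if_le (by fun_prop) continuous_const (by fun_prop) hb' hab'⟩, fun x hx => ?_,
    fun x t s hx => ?_⟩
  · change (if ‖x.1‖ ≤ 1 then a (truncate x.1) else b' x) = _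
    rw [if_pos hx, ha x hx]
  · have hs : ‖s.1‖ = 1 := mem_sphere_zero_iff_norm.1 s.2
    have ht : 0 < 1 + t.1 := by linarith [t.2.1]
    have hx' : ‖x.1‖ = 1 + t.1 := by
      rw [hx, norm_smul, hs, mul_one, Real.norm_eq_abs, abs_of_pos ht]
    have hx₁ : 1 ≤ ‖x.1‖ := by linarith [t.2.1]
    have key : b' x = b (t, s) := by
      simp only [b', hx₁, dite_true]
      congr 1
      refine Prod.ext ?_ (Subtype.ext ?_)
      · simp [g, hx']
      · change ‖x.1‖⁻¹ • x.1 = s.1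
        rw [hx', hx, smul_smul, inv_mul_cancel₀ ht.ne', one_smul]
    change (if ‖x.1‖ ≤ 1 then a (truncate x.1) else b' x) = _
    split_ifs with h
    · rw [hab' x (le_antisymm h hx₁), key]
    · exact key

variable {Y B : Type*} [TopologicalSpace Y] [TopologicalSpace B] (p : C(Y, B))

/-- Lifting up to homotopy relative to the boundary is invariant under deformations of the
map on the sphere. -/
lemma exists_lift_of_homotopy {n : ℕ} {α α' : C(UnitSphere n, Y)} (h : α.Homotopy α')
    (β : C(UnitBall n, B)) (hβ : ∀ s, β (sphereToBall n s) = p (α s))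
    (hα' : ∀ β' : C(UnitBall n, B), (∀ s, β' (sphereToBall n s) = p (α' s)) →
      ∃ γ' : C(UnitBall n, Y), (∀ s, γ' (sphereToBall n s) = α' s) ∧ ∀ u, p (γ' u) = β' u) :
    ∃ γ : C(UnitBall n, Y), (∀ s, γ (sphereToBall n s) = α s) ∧
      (p.comp γ).HomotopicRel β (range (sphereToBall n)) := by
  -- Adding the collar `p ∘ h` to `β` changes the boundary values from `p ∘ α` to `p ∘ α'`.
  obtain ⟨k, hk₁, hk₂⟩ := exists_glue β (p.comp h.toContinuousMap) (fun s => by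
    rw [hβ]
    exact congrArg p (h.apply_zero s).symm)
  let d : C(UnitBall n, closedBall (0 : EuclideanSpace ℝ (Fin n)) 2) :=
    ⟨fun u => ⟨(2 : ℝ) • u.1, by
      have := mem_closedBall_zero_iff.1 u.2
      rw [mem_closedBall_zero_iff, norm_smul, Real.norm_ofNat]
      linarith⟩, by fun_prop⟩
  have hd (s : UnitSphere n) : (d (sphereToBall n s)).1 = (1 + (1 : I).1) • s.1 := by
    change (2 : ℝ) • s.1 = (1 + 1 : ℝ) • s.1
    norm_num
  obtain ⟨γ', hγ', hγ'p⟩ := hα' (k.comp d) (fun s => by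
    rw [ContinuousMap.comp_apply, hk₂ _ 1 s (hd s)]
    exact congrArg p (h.apply_one s))
  -- The reversed homotopy on the collar brings the boundary values back to `α`.
  obtain ⟨l, hl₁, hl₂⟩ := exists_glue γ' h.symm.toContinuousMap (fun s => by
    rw [hγ']
    exact (h.symm.apply_zero s).symm)
  -- The fold `x ↦ c x • x` doubles the unit ball and reflects the collar, replacing the norm by 3 -
  -- ‖x‖; it turns `k` into `p ∘ l`.
  let c (x : EuclideanSpace ℝ (Fin n)) : ℝ := (3 - max 1 ‖x‖) / max 1 ‖x‖
  have hc : Continuous c := by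
    have hm : Continuous fun x : EuclideanSpace ℝ (Fin n) => max 1 ‖x‖ :=
      continuous_const.max continuous_norm
    exact (continuous_const.sub hm).div hm fun x => (lt_max_of_lt_left one_pos).ne'
  have hcb (x : EuclideanSpace ℝ (Fin n)) (hx : ‖x‖ ≤ 2) : ‖c x • x‖ ≤ 2 := by
    have h₀ : 0 < max 1 ‖x‖ := lt_max_of_lt_left one_pos
    have h₁ : max 1 ‖x‖ ≤ 2 := max_le one_le_two hx
    have h₂ : 0 ≤ c x := div_nonneg (by linarith) h₀.le
    rw [norm_smul, Real.norm_eq_abs, abs_of_nonneg h₂, div_mul_eq_mul_div, div_le_iff₀ h₀]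
    nlinarith [le_max_left 1 ‖x‖, le_max_right 1 ‖x‖, norm_nonneg x]
  have hpl (x : closedBall (0 : EuclideanSpace ℝ (Fin n)) 2) :
      p (l x) = k ⟨c x.1 • x.1,
        mem_closedBall_zero_iff.2 (hcb _ (mem_closedBall_zero_iff.1 x.2))⟩ := by
    by_cases hx : ‖x.1‖ ≤ 1
    · rw [hl₁ x hx, hγ'p, ContinuousMap.comp_apply]
      congr 1
      ext1
      change (2 : ℝ) • x.1 = c x.1 • x.1
      simp only [c, max_eq_left hx]
      norm_num
    · have hx₁ : 1 ≤ ‖x.1‖ := (not_le.1 hx).le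
      have hx₂ : ‖x.1‖ ≤ 2 := mem_closedBall_zero_iff.1 x.2
      have hx₀ : ‖x.1‖ ≠ 0 := (one_pos.trans_le hx₁).ne'
      let t : I := ⟨‖x.1‖ - 1, by linarith, by linarith⟩
      let s : UnitSphere n := ⟨‖x.1‖⁻¹ • x.1, by
        rw [mem_sphere_zero_iff_norm, norm_smul, norm_inv, norm_norm, inv_mul_cancel₀ hx₀]⟩
      rw [hl₂ x t s, hk₂ _ (unitInterval.symm t) s]
      · rfl
      · change c x.1 • x.1 = (1 + (1 - (‖x.1‖ - 1))) • ‖x.1‖⁻¹ • x.1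
        simp only [c, max_eq_right hx₁, smul_smul]
        congr 1
        ring
      · change x.1 = (1 + (‖x.1‖ - 1)) • ‖x.1‖⁻¹ • x.1
        rw [smul_smul, add_sub_cancel, mul_inv_cancel₀ hx₀, one_smul]
  have hdc (s : UnitSphere n) :
      c (d (sphereToBall n s)).1 • (d (sphereToBall n s)).1 = s.1 := by
    have : ‖(2 : ℝ) • s.1‖ = 2 := by
      rw [norm_smul, mem_sphere_zero_iff_norm.1 s.2]
      norm_num
    change c ((2 : ℝ) • s.1) • ((2 : ℝ) • s.1) = s.1
    simp only [c, this, smul_smul]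
    norm_num
  -- Straight lines in the convex ball of radius 2 from the fold of `2u` to `u`. On the unit sphere
  -- the two ends coincide, so the homotopy is constant there.
  let G : C(I × UnitBall n, closedBall (0 : EuclideanSpace ℝ (Fin n)) 2) :=
    ⟨fun q => ⟨(1 - q.1.1) • c (d q.2).1 • (d q.2).1 + q.1.1 • q.2.1, by
      refine (convex_closedBall (0 : EuclideanSpace ℝ (Fin n)) 2)
        (mem_closedBall_zero_iff.2 (hcb _ (mem_closedBall_zero_iff.1 (d q.2).2))) ?_
        (by linarith [q.1.2.2]) q.1.2.1 (by ring)
      exact closedBall_subset_closedBall one_le_two q.2.2⟩, by fun_prop⟩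
  refine ⟨l.comp d, fun s => ?_, ⟨⟨⟨k.comp G, fun u => ?_, fun u => ?_⟩, ?_⟩⟩⟩
  · rw [ContinuousMap.comp_apply, hl₂ _ 1 s (hd s)]
    exact h.symm.apply_one s
  · refine Eq.trans (congrArg k (Subtype.ext ?_)) (hpl (d u)).symm
    change (1 - (0 : ℝ)) • c (d u).1 • (d u).1 + (0 : ℝ) • u.1 = _
    simp
  · change k (G (1, u)) = β u
    have : (G (1, u)).1 = u.1 := by
      change (1 - (1 : ℝ)) • c (d u).1 • (d u).1 + (1 : ℝ) • u.1 = _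
      simp
    rw [hk₁ _ (this ▸ mem_closedBall_zero_iff.1 u.2)]
    exact congrArg β (Subtype.ext this)
  · rintro t _ ⟨s, rfl⟩
    refine Eq.trans (congrArg k (Subtype.ext ?_)) (hpl _).symm
    change (1 - t.1) • c (d (sphereToBall n s)).1 • (d (sphereToBall n s)).1 + t.1 • s.1 =
      c (d (sphereToBall n s)).1 • (d (sphereToBall n s)).1
    rw [hdc, ← add_smul, sub_add_cancel, one_smul]

end Lifting

/-! ### From disk lifting to weak equivalence. -/

section Cube

open Metric Set
open scoped unitInterval

/-- The cube is homeomorphic to the ball, compatibly with the boundaries. -/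
lemma exists_homeomorph_cube_unitBall (n : ℕ) :
    ∃ e : (Fin n → I) ≃ₜ UnitBall n, ∀ y, y ∈ Cube.boundary (Fin n) ↔ ‖(e y).1‖ = 1 := by
  let L : EuclideanSpace ℝ (Fin n) ≃ₜ (Fin n → ℝ) :=
    (EuclideanSpace.equiv (Fin n) ℝ).toHomeomorph
  let s : Set (EuclideanSpace ℝ (Fin n)) := L ⁻¹' (Set.pi univ fun _ => Icc 0 1)
  have hs : IsClosed s := (isClosed_set_pi fun _ _ => isClosed_Icc).preimage L.continuous
  have hsi : interior s = L ⁻¹' (Set.pi univ fun _ => Ioo 0 1) := by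
    rw [← L.preimage_interior, interior_pi_set finite_univ]
    simp
  have hsc : Convex ℝ s := (convex_pi fun _ _ => convex_Icc _ _).linear_preimage
    (EuclideanSpace.equiv (Fin n) ℝ).toLinearMap
  have hsb : Bornology.IsBounded s := by
    have : IsCompact s := L.isCompact_preimage.2 (isCompact_univ_pi fun _ => isCompact_Icc)
    exact this.isBounded
  have hsne : (interior s).Nonempty := by
    rw [hsi]
    refine ⟨L.symm fun _ => 1 / 2, ?_⟩
    rw [mem_preimage, L.apply_symm_apply]
    exact fun i _ => ⟨by norm_num, by norm_num⟩
  obtain ⟨h, -, hh, hhf⟩ := exists_homeomorph_image_interior_closure_frontier_eq_unitBall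
    hsc hsne hsb
  rw [hs.closure_eq] at hh
  let c : (Fin n → I) ≃ₜ s :=
    { toFun := fun y => ⟨L.symm fun i => (y i).1, by
        rw [mem_preimage, L.apply_symm_apply]
        exact fun i _ => (y i).2⟩
      invFun := fun x i => ⟨L x.1 i, x.2 i (mem_univ i)⟩
      left_inv := fun y => by simp
      right_inv := fun x => by simp }
  let e : (Fin n → I) ≃ₜ UnitBall n := c.trans ((h.image s).trans (Homeomorph.setCongr hh))
  refine ⟨e, fun y => ?_⟩
  have he : (e y).1 = h (c y).1 := rfl
  have h₁ : ‖(e y).1‖ = 1 ↔ (c y).1 ∈ frontier s := by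
    rw [he, ← mem_sphere_zero_iff_norm, ← hhf, h.injective.mem_set_image]
  rw [h₁, hs.frontier_eq, hsi, mem_sdiff, and_iff_right (c y).2, mem_preimage]
  change _ ↔ L (L.symm fun i => (y i).1) ∉ _
  rw [L.apply_symm_apply]
  simp only [Cube.boundary, mem_ofPred_eq, mem_univ_pi, not_forall]
  refine exists_congr fun i => ?_
  have h₀ := (y i).2
  rw [mem_Ioo, not_and_or, not_lt, not_lt, Subtype.ext_iff, Subtype.ext_iff]
  exact or_congr ⟨fun h => h.le, fun h => le_antisymm h h₀.1⟩
    ⟨fun h => h.ge, fun h => le_antisymm h₀.2 h⟩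

variable {Y B : Type*} [TopologicalSpace Y] [TopologicalSpace B]

/-- A map has the lifting property up to homotopy with respect to the pairs `(D^n, S^{n-1})`. -/
def LiftsDisks (p : C(Y, B)) : Prop :=
  ∀ (n : ℕ) (α : C(UnitSphere n, Y)) (β : C(UnitBall n, B)),
    (∀ s, β (sphereToBall n s) = p (α s)) →
    ∃ γ : C(UnitBall n, Y), (∀ s, γ (sphereToBall n s) = α s) ∧
      (p.comp γ).HomotopicRel β (range (sphereToBall n))

variable {p : C(Y, B)} (hp : LiftsDisks p)

include hp

lemma LiftsDisks.exists_cube_lift {n : ℕ} (α : C(Cube.boundary (Fin n), Y))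
    (β : C(Fin n → I, B)) (h : ∀ y, β y.1 = p (α y)) :
    ∃ γ : C(Fin n → I, Y), (∀ y, γ y.1 = α y) ∧
      (p.comp γ).HomotopicRel β (Cube.boundary (Fin n)) := by
  obtain ⟨e, he⟩ := exists_homeomorph_cube_unitBall n
  have he' (s : UnitSphere n) : e.symm (sphereToBall n s) ∈ Cube.boundary (Fin n) := by
    rw [he, e.apply_symm_apply]
    exact norm_sphereToBall s
  have hes (y) (hy : y ∈ Cube.boundary (Fin n)) : ∃ s, sphereToBall n s = e y :=
    ⟨⟨(e y).1, mem_sphere_zero_iff_norm.2 ((he y).1 hy)⟩, rfl⟩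
  obtain ⟨γ, hγ, ⟨H⟩⟩ := hp n
    (α.comp ⟨fun s => ⟨e.symm (sphereToBall n s), he' s⟩, by fun_prop⟩)
    (β.comp ⟨e.symm, e.symm.continuous⟩) (fun s => h ⟨_, he' s⟩)
  refine ⟨γ.comp ⟨e, e.continuous⟩, fun y => ?_, ⟨⟨⟨H.toContinuousMap.comp
    ((ContinuousMap.id I).prodMap ⟨e, e.continuous⟩), fun y => ?_, fun y => ?_⟩, ?_⟩⟩⟩
  · obtain ⟨s, hs⟩ := hes y.1 y.2
    change γ (e y) = _
    rw [← hs, hγ]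
    refine congrArg α (Subtype.ext ?_)
    change e.symm (sphereToBall n s) = y
    rw [hs, e.symm_apply_apply]
  · exact H.apply_zero (e y)
  · exact (H.apply_one (e y)).trans (congrArg β (e.symm_apply_apply y))
  · intro t y hy
    obtain ⟨s, hs⟩ := hes y hy
    exact H.eq_fst t ⟨s, hs⟩

/-- The homotopy in `B` is a map on the (n+1)-cube whose boundary values are already lifted. Only
the exact boundary values of its lift are needed. -/
lemma LiftsDisks.homotopicRel {n : ℕ} {γ₀ γ₁ : C(Fin n → I, Y)}
    (h : EqOn γ₀ γ₁ (Cube.boundary (Fin n)))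
    (H : (p.comp γ₀).HomotopicRel (p.comp γ₁) (Cube.boundary (Fin n))) :
    γ₀.HomotopicRel γ₁ (Cube.boundary (Fin n)) := by
  obtain ⟨G⟩ := H
  let β : C(Fin (n + 1) → I, B) := ⟨fun y => G (y 0, Fin.tail y), by unfold Fin.tail; fun_prop⟩
  -- Boundary points at height 1/2 lie on the sides of the cube, where `γ₀` and `γ₁` agree, so the
  -- cut there is continuous.
  let α (y : Fin (n + 1) → I) : Y :=
    if (y 0).1 ≤ 1 / 2 then γ₀ (Fin.tail y) else γ₁ (Fin.tail y)
  have htail {y : Fin (n + 1) → I} (hy : y ∈ Cube.boundary (Fin (n + 1))) (h₀ : y 0 ≠ 0)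
      (h₁ : y 0 ≠ 1) : Fin.tail y ∈ Cube.boundary (Fin n) := by
    obtain ⟨i, hi⟩ := hy
    obtain rfl | ⟨i, rfl⟩ := i.eq_zero_or_eq_succ
    · exact absurd hi (by tauto)
    · exact ⟨i, hi⟩
  have hα : Continuous fun y : Cube.boundary (Fin (n + 1)) => α y.1 := by
    have ht : Continuous fun y : Cube.boundary (Fin (n + 1)) => Fin.tail y.1 :=
      continuous_pi fun i => (continuous_apply i.succ).comp continuous_subtype_val
    refine Continuous.if_le (γ₀.continuous.comp ht) (γ₁.continuous.comp ht)
      (continuous_subtype_val.comp ((continuous_apply 0).comp continuous_subtype_val))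
      continuous_const fun y hy => h (htail y.2 ?_ ?_)
    · intro h
      rw [h] at hy
      norm_num at hy
    · intro h
      rw [h] at hy
      norm_num at hy
  have hα₀ (y : Fin n → I) : α (Fin.cons 0 y) = γ₀ y := by
    simp [α]
  have hα₁ (y : Fin n → I) : α (Fin.cons 1 y) = γ₁ y := by
    have : ¬ ((1 : ℝ) ≤ 1 / 2) := by norm_num
    simp only [α, Fin.cons_zero, Fin.tail_cons, Icc.coe_one, if_neg this]
  have hα_boundary (t : I) (y) (hy : y ∈ Cube.boundary (Fin n)) : α (Fin.cons t y) = γ₀ y := by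
    simp only [α, Fin.cons_zero, Fin.tail_cons]
    split_ifs
    · rfl
    · exact (h hy).symm
  have cons_mem {t : I} {y : Fin n → I} (h : t = 0 ∨ t = 1 ∨ y ∈ Cube.boundary (Fin n)) :
      (Fin.cons t y : Fin (n + 1) → I) ∈ Cube.boundary (Fin (n + 1)) := by
    obtain h | h | ⟨i, hi⟩ := h
    · exact ⟨0, Or.inl h⟩
    · exact ⟨0, Or.inr h⟩
    · exact ⟨i.succ, hi⟩
  have hβ (y : Fin (n + 1) → I) (hy : y ∈ Cube.boundary (Fin (n + 1))) : β y = p (α y) := by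
    change G (y 0, Fin.tail y) = _
    obtain ⟨t, z, rfl⟩ : ∃ t z, y = Fin.cons t z := ⟨y 0, Fin.tail y, (Fin.cons_self_tail y).symm⟩
    rw [Fin.cons_zero, Fin.tail_cons]
    by_cases h₀ : t = 0
    · rw [h₀, hα₀]
      exact G.apply_zero z
    · by_cases h₁ : t = 1
      · rw [h₁, hα₁]
        exact G.apply_one z
      · have hz : z ∈ Cube.boundary (Fin n) := htail hy h₀ h₁
        rw [hα_boundary t z hz]
        exact G.eq_fst t hz
  obtain ⟨γ, hγ, -⟩ := hp.exists_cube_lift ⟨fun y => α y.1, hα⟩ β (fun y => hβ y.1 y.2)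
  refine ⟨⟨⟨⟨fun q => γ (Fin.cons q.1 q.2), ?_⟩, fun y => ?_, fun y => ?_⟩, ?_⟩⟩
  · exact γ.continuous.comp (continuous_pi (Fin.cases continuous_fst fun i =>
      (continuous_apply i).comp continuous_snd))
  · exact (hγ ⟨_, cons_mem (Or.inl rfl)⟩).trans (hα₀ y)
  · exact (hγ ⟨_, cons_mem (Or.inr (Or.inl rfl))⟩).trans (hα₁ y)
  · intro t y hy
    exact (hγ ⟨_, cons_mem (Or.inr (Or.inr hy))⟩).trans (hα_boundary t y hy)

lemma LiftsDisks.bijective_homotopyGroupMap (n : ℕ) (x : Y) :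
    Function.Bijective (homotopyGroupMap p n x) := by
  constructor
  · rintro ⟨γ₀⟩ ⟨γ₁⟩ h
    refine Quotient.sound (hp.homotopicRel (fun y hy => ?_) (Quotient.exact h))
    exact (γ₀.2 y hy).trans (γ₁.2 y hy).symm
  · rintro ⟨β⟩
    obtain ⟨γ, hγ, H⟩ := hp.exists_cube_lift (ContinuousMap.const _ x) β.1
      (fun y => β.2 y.1 y.2)
    exact ⟨⟦⟨γ, fun y hy => hγ ⟨y, hy⟩⟩⟧, Quotient.sound H⟩

/-- The 0-cube is a point with empty boundary, so its homotopies are paths. -/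
lemma LiftsDisks.bijective_pathComponentsMap : Function.Bijective (pathComponentsMap p) := by
  have empty (y : Fin 0 → I) : y ∉ Cube.boundary (Fin 0) := fun ⟨i, _⟩ => i.elim0
  constructor
  · rintro ⟨y₀⟩ ⟨y₁⟩ h
    obtain ⟨P⟩ : Joined (p y₀) (p y₁) := Quotient.exact h
    obtain ⟨H⟩ := hp.homotopicRel (n := 0) (γ₀ := .const _ y₀) (γ₁ := .const _ y₁)
      (fun y hy => absurd hy (empty y))
      ⟨⟨⟨P.toContinuousMap.comp .fst, fun _ => P.source, fun _ => P.target⟩,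
        fun _ y hy => absurd hy (empty y)⟩⟩
    exact Quotient.sound ⟨H.toHomotopy.evalAt 0⟩
  · rintro ⟨b⟩
    obtain ⟨γ, -, ⟨H⟩⟩ := hp.exists_cube_lift (n := 0) ⟨fun y => absurd y.2 (empty y.1), by
      rw [continuous_iff_continuousAt]
      exact fun y => absurd y.2 (empty y.1)⟩ (.const _ b) (fun y => absurd y.2 (empty y.1))
    exact ⟨⟦γ 0⟧, Quotient.sound ⟨H.toHomotopy.evalAt 0⟩⟩

lemma LiftsDisks.isWeakHomotopyEquiv : IsWeakHomotopyEquiv p :=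
  ⟨hp.bijective_pathComponentsMap, fun n _ x => hp.bijective_homotopyGroupMap n x⟩

end Cube

/-! ### Lifting property of the cell-per-square construction. -/

section CellPerSquare

variable {A Y B : TopCat.{u}} {j : A ⟶ Y} {p : Y ⟶ B}

/-- The data form a square over A_{n-1}, and the characteristic map of its cell is the lift. -/
lemma CellPerSquare.exists_lift {c : RelativeCWComplex j} (k : CellPerSquare c p) {n : ℕ}
    (α : C(UnitSphere n, c.F.obj n)) (β : C(UnitBall n, B))
    (h : ∀ s, β (sphereToBall n s) = p (c.incl.app n (α s))) :
    ∃ γ : C(UnitBall n, Y), (∀ s, γ (sphereToBall n s) = c.incl.app n (α s)) ∧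
      ∀ u, p (γ u) = β u := by
  let s : Square n (stageMap c p n) := Arrow.homMk
    (TopCat.ofHom (α.comp ⟨ULift.down, continuous_uliftDown⟩))
    (TopCat.ofHom (β.comp ⟨ULift.down, continuous_uliftDown⟩)) (by
      ext x
      exact (h x.down).symm)
  have h₁ := k.attachingMap_cellOf n s
  have h₂ := k.characteristicMap_cellOf n s
  refine ⟨(c.incl.app (n + 1)).hom.comp
    (charMap (c.attachCells n (not_isMax n)) (k.cellOf n s)), fun x => ?_, fun x => ?_⟩
  · have : attach (c.attachCells n (not_isMax n)) (k.cellOf n s) x = α x :=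
      congrArg (fun l => l (ULift.up x)) h₁
    exact (congrArg (c.incl.app (n + 1)) ((charMap_sphereToBall _ _ x).trans
      (congrArg _ this))).trans (incl_map c (Nat.le_succ n) _)
  · exact congrArg (fun l => l (ULift.up x)) h₂

lemma CellPerSquare.liftsDisks {c : RelativeCWComplex j} (k : CellPerSquare c p) :
    LiftsDisks p.hom := by
  intro n α β h
  obtain ⟨α', ⟨H⟩⟩ := exists_homotopic_incl c n (fun m hm => avoidsOrigin_sphere hm) α
  exact exists_lift_of_homotopy p.hom H β h fun β' h' => k.exists_lift α' β' h'

lemma CellPerSquare.weakEquivalences {c : RelativeCWComplex j} (k : CellPerSquare c p) :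
    weakEquivalences p :=
  k.liftsDisks.isWeakHomotopyEquiv

end CellPerSquare

/-! ### The stages, their colimit and functoriality. -/

section Construction

open SmallObject

/-- This is the source of `PreservesCells`. -/
lemma ι_ρ_functorMap {n : ℕ} {X Y B B' : TopCat.{u}} {q : X ⟶ B} {q' : Y ⟶ B'}
    (τ : Arrow.mk q ⟶ Arrow.mk q') (x : FunctorObjIndex (RelativeCWComplex.basicCell.{u} n) q) :
    (Sigma.ι (functorObjTgtFamily (RelativeCWComplex.basicCell.{u} n) q) x ≫
      ρFunctorObj (RelativeCWComplex.basicCell.{u} n) q) ≫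
        functorMap (RelativeCWComplex.basicCell.{u} n) τ =
      Sigma.ι (functorObjTgtFamily (RelativeCWComplex.basicCell.{u} n) q')
        (FunctorObjIndex.mk x.i (x.t ≫ τ.left) (x.b ≫ τ.right)
          ((Category.assoc _ _ _).trans ((congrArg (fun k => x.t ≫ k) τ.w).trans
            (x.w_assoc τ.right)))) ≫
        ρFunctorObj (RelativeCWComplex.basicCell.{u} n) q' := by
  rw [functorMap, Category.assoc, pushout.inr_desc]
  exact ι_functorMapTgt_assoc (RelativeCWComplex.basicCell.{u} n) τ x.i x.t x.b x.w _ rfl _ rfl _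

/-- The spaces `A_{n-1}` over `B` which are obtained from `f : A ⟶ B` by successively attaching one
cell for each commutative square. -/
def stage (f : Arrow TopCat.{u}) : ℕ → Σ X : TopCat.{u}, (X ⟶ f.right)
  | 0 => ⟨f.left, f.hom⟩
  | n + 1 => ⟨_, πFunctorObj (RelativeCWComplex.basicCell.{u} n) (stage f n).2⟩

/-- The inclusion `A_{n-1} ⟶ A_n`. -/
def stageIncl (f : Arrow TopCat.{u}) (n : ℕ) : (stage f n).1 ⟶ (stage f (n + 1)).1 :=
  ιFunctorObj (RelativeCWComplex.basicCell.{u} n) (stage f n).2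

lemma stageIncl_comp (f : Arrow TopCat.{u}) (n : ℕ) :
    stageIncl f n ≫ (stage f (n + 1)).2 = (stage f n).2 :=
  ιFunctorObj_πFunctorObj _ _

/-- The functoriality of the maps `A_{n-1} ⟶ B`. -/
def stageArrowMap {f g : Arrow TopCat.{u}} (φ : f ⟶ g) :
    ∀ n, {h : (stage f n).1 ⟶ (stage g n).1 // h ≫ (stage g n).2 = (stage f n).2 ≫ φ.right}
  | 0 => ⟨φ.left, φ.w⟩
  | n + 1 => ⟨functorMap (RelativeCWComplex.basicCell.{u} n)
      (Arrow.homMk (stageArrowMap φ n).1 φ.right (stageArrowMap φ n).2), functorMap_π _ _⟩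

lemma stageArrowMap_incl {f g : Arrow TopCat.{u}} (φ : f ⟶ g) (n : ℕ) :
    stageIncl f n ≫ (stageArrowMap φ (n + 1)).1 = (stageArrowMap φ n).1 ≫ stageIncl g n :=
  ιFunctorObj_naturality _ _

/-- The morphism of arrows from `A_{n-1} ⟶ B` to `A'_{n-1} ⟶ B'`. -/
def stageHom {f g : Arrow TopCat.{u}} (φ : f ⟶ g) (n : ℕ) :
    Arrow.mk (stage f n).2 ⟶ Arrow.mk (stage g n).2 :=
  Arrow.homMk (stageArrowMap φ n).1 φ.right (stageArrowMap φ n).2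

lemma stageArrowMap_succ {f g : Arrow TopCat.{u}} (φ : f ⟶ g) (n : ℕ) :
    (stageArrowMap φ (n + 1)).1 =
      functorMap (RelativeCWComplex.basicCell.{u} n) (stageHom φ n) :=
  rfl

lemma stageArrowMap_id (f : Arrow TopCat.{u}) (n : ℕ) : (stageArrowMap (𝟙 f) n).1 = 𝟙 _ := by
  induction n with
  | zero => rfl
  | succ n ih =>
    have h : stageHom (𝟙 f) n = 𝟙 _ := by
      ext1
      · exact ih
      · rfl
    rw [stageArrowMap_succ, h]
    exact functorMap_id _ _

lemma stageArrowMap_comp {f g h : Arrow TopCat.{u}} (φ : f ⟶ g) (ψ : g ⟶ h) (n : ℕ) :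
    (stageArrowMap (φ ≫ ψ) n).1 = (stageArrowMap φ n).1 ≫ (stageArrowMap ψ n).1 := by
  induction n with
  | zero => rfl
  | succ n ih =>
    have h : stageHom (φ ≫ ψ) n = stageHom φ n ≫ stageHom ψ n := by
      ext1
      · exact ih
      · rfl
    rw [stageArrowMap_succ, h]
    exact congrArg (fun k => k.left)
      ((SmallObject.functor (RelativeCWComplex.basicCell.{u} n)).map_comp
        (stageHom φ n) (stageHom ψ n))

/-- The sequence of the spaces `A_{n-1}`. -/
def stageFunctor (f : Arrow TopCat.{u}) : ℕ ⥤ TopCat.{u} := Functor.ofSequence (stageIncl f)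

lemma stageFunctor_map_succ (f : Arrow TopCat.{u}) (n : ℕ) :
    (stageFunctor f).map (homOfLE (n.le_add_right 1)) = stageIncl f n :=
  Functor.ofSequence_map_homOfLE_succ _ n

/-- The map of sequences `A_{n-1} ⟶ A'_{n-1}` induced by a morphism of arrows. -/
def stageNatTrans {f g : Arrow TopCat.{u}} (φ : f ⟶ g) : stageFunctor f ⟶ stageFunctor g :=
  NatTrans.ofSequence (fun n => (stageArrowMap φ n).1) (fun n => by
    rw [stageFunctor_map_succ, stageFunctor_map_succ]
    exact stageArrowMap_incl φ n)

/-- The maps `A_{n-1} ⟶ B` as a cocone. -/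
def stageCocone (f : Arrow TopCat.{u}) : Cocone (stageFunctor f) where
  pt := f.right
  ι := NatTrans.ofSequence (fun n => (stage f n).2) (fun n => by
    rw [stageFunctor_map_succ]
    exact stageIncl_comp f n)

/-- The functor which sends `f : A ⟶ B` to the colimit of the spaces `A_{n-1}`. -/
def middle : Arrow TopCat.{u} ⥤ TopCat.{u} where
  obj f := colimit (stageFunctor f)
  map φ := colimMap (stageNatTrans φ)
  map_id f := by
    refine colimit.hom_ext fun n => ?_
    rw [ι_colimMap, Category.comp_id]
    exact (congrArg (fun k => k ≫ colimit.ι (stageFunctor f) n) (stageArrowMap_id f n)).trans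
      (Category.id_comp _)
  map_comp {f g h} φ ψ := by
    refine colimit.hom_ext fun n => ?_
    rw [ι_colimMap, ι_colimMap_assoc, ι_colimMap]
    exact (congrArg (fun k => k ≫ colimit.ι (stageFunctor h) n) (stageArrowMap_comp φ ψ n)).trans
      (Category.assoc _ _ _)

/-- The canonical map `A ⟶ B̃`. -/
def toMiddle : Arrow.leftFunc ⟶ middle.{u} where
  app f := colimit.ι (stageFunctor f) 0
  naturality _ _ φ := (ι_colimMap (stageNatTrans φ) 0).symm

/-- The canonical map `B̃ ⟶ B`. -/
def fromMiddle : middle.{u} ⟶ Arrow.rightFunc where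
  app f := colimit.desc _ (stageCocone f)
  naturality f g φ := by
    refine colimit.hom_ext fun n => ?_
    refine (ι_colimMap_assoc (stageNatTrans φ) n _).trans ?_
    refine Eq.trans (congrArg (fun k => (stageArrowMap φ n).1 ≫ k)
      (colimit.ι_desc (stageCocone g) n)) ?_
    refine Eq.trans ?_ (colimit.ι_desc_assoc (stageCocone f) n _).symm
    exact (stageArrowMap φ n).2

lemma toMiddle_fromMiddle : toMiddle.{u} ≫ fromMiddle = Arrow.leftToRight := by
  ext f : 2
  exact colimit.ι_desc (stageCocone f) 0

/-- The relative CW-complex `A ⟶ B̃`. -/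
def middleCW (f : Arrow TopCat.{u}) : RelativeCWComplex (toMiddle.app f) where
  F := stageFunctor f
  isoBot := Iso.refl _
  incl := (colimit.cocone (stageFunctor f)).ι
  isColimit := colimit.isColimit _
  fac := Category.id_comp _
  attachCells n _ :=
    (attachCellsιFunctorObj (RelativeCWComplex.basicCell.{u} n) (stage f n).2).ofArrowIso
      (Arrow.isoMk (Iso.refl _) (Iso.refl _) (by
        refine (Category.id_comp _).trans (Eq.trans ?_ (Category.comp_id _).symm)
        exact stageFunctor_map_succ f n))

lemma stageMap_middleCW (f : Arrow TopCat.{u}) (n : ℕ) :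
    stageMap (middleCW f) (fromMiddle.app f) n = (stage f n).2 :=
  colimit.ι_desc (stageCocone f) n

lemma characteristicMap_middleCW (f : Arrow TopCat.{u}) (n : ℕ)
    (x : FunctorObjIndex (RelativeCWComplex.basicCell.{u} n) (stage f n).2) :
    characteristicMap (middleCW f) n x =
      Sigma.ι (functorObjTgtFamily (RelativeCWComplex.basicCell.{u} n) (stage f n).2) x ≫
        ρFunctorObj (RelativeCWComplex.basicCell.{u} n) (stage f n).2 :=
  congrArg (fun k => Sigma.ι (functorObjTgtFamily (RelativeCWComplex.basicCell.{u} n)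
    (stage f n).2) x ≫ k) (Category.comp_id _)

/-- The cells of `A ⟶ B̃` correspond to commutative squares. -/
def middleCells (f : Arrow TopCat.{u}) : CellPerSquare (middleCW f) (fromMiddle.app f) where
  cellOf n :=
    -- The family `basicCell n` has a single member, hence the index `()`.
    { toFun := fun s => FunctorObjIndex.mk () s.left s.right
        ((congrArg (fun k => s.left ≫ k) (stageMap_middleCW f n)).symm.trans s.w)
      invFun := fun x => Arrow.homMk x.t x.b
        ((congrArg (fun k => x.t ≫ k) (stageMap_middleCW f n)).trans x.w)
      left_inv := fun _ => rfl
      right_inv := fun _ => rfl }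
  attachingMap_cellOf n s :=
    (congrArg (fun k => _ ≫ k) (Category.comp_id _)).trans (colimit.ι_desc _ _)
  characteristicMap_cellOf n s := by
    refine Eq.trans (congrArg₂ (fun k l => k ≫ l) (characteristicMap_middleCW f n _)
      (stageMap_middleCW f (n + 1))) ?_
    refine (Category.assoc _ _ _).trans ?_
    exact (congrArg (fun k => _ ≫ k) (ρFunctorObj_π _ _)).trans (colimit.ι_desc _ _)

/-- The functorial factorization of continuous maps obtained by attaching cells. -/
def factorization : CWFactorization.{u} where
  Z := middle
  i := toMiddle
  p := fromMiddle
  fac := toMiddle_fromMiddle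
  hi f := ⟨middleCW f⟩
  hp f := (middleCells f).weakEquivalences

/-- The maps of stages induced by a morphism of arrows. -/
def middleStages {f g : Arrow TopCat.{u}} (φ : f ⟶ g) :
    StageMaps (middleCW f) (middleCW g) φ.left (middle.map φ) where
  map := stageNatTrans φ
  map_zero := (Category.id_comp _).trans (Category.comp_id _).symm
  map_incl n := (ι_colimMap (stageNatTrans φ) n).symm

lemma middleStages_preservesCells {f g : Arrow TopCat.{u}} (φ : f ⟶ g) :
    (middleStages φ).PreservesCells (fromMiddle.naturality φ) (middleCells f) (middleCells g) := by
  intro n s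
  refine Eq.trans (congrArg (fun k => k ≫ (stageArrowMap φ (n + 1)).1)
    (characteristicMap_middleCW f n _)) ?_
  exact (ι_ρ_functorMap (stageHom φ n) _).trans (characteristicMap_middleCW g n _).symm

/-- The factorization is built by attaching one cell for each commutative square. -/
def builtFromSquares : BuiltFromSquares factorization.{u} where
  cw := middleCW
  cells := middleCells
  stages := middleStages
  preservesCells := middleStages_preservesCells

end Construction

/-- By initiality the first factor is the canonical map ∅ → B̃, and a relative CW structure on that
map is a CW structure on B̃. -/
lemma isFunctorialCWApproximation (F : CWFactorization.{u}) :
    IsFunctorialCWApproximation (approximation F) (approximationMap F) := by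
  intro B
  refine ⟨?_, F.hp _⟩
  obtain ⟨c⟩ := F.hi (fromEmpty.obj B)
  have : F.i.app (fromEmpty.obj B) = initial.to _ := initialIsInitial.hom_ext _ _
  rw [this] at c
  exact ⟨c⟩

end

end FunctorialCW

theorem theorem2p1 :
    ∃ F : FunctorialCW.CWFactorization.{u},
      Nonempty (FunctorialCW.BuiltFromSquares F) ∧
      FunctorialCW.IsFunctorialCWApproximation
        (FunctorialCW.approximation F) (FunctorialCW.approximationMap F) :=
  ⟨FunctorialCW.factorization, ⟨FunctorialCW.builtFromSquares⟩,
    FunctorialCW.isFunctorialCWApproximation _⟩
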